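/- Theorem 1.6. Let $X$ be a finite simplicial complex whose set of vertices ($0$-simplices) has $n$ elements, and let $k\ge 1$ be such that $X$ has at least one $k$-simplex. For $i\ge 0$ let $C^i(X;\mathbb R)$ be the space of real $i$-cochains, i.e. of functions $\phi$ on the oriented $i$-simplices of $X$ that change sign with the orientation; let $C^{-1}(X;\mathbb R)=\mathbb R$. Give $C^i(X;\mathbb R)$ the inner product $\langle\phi,\psi\rangle=\sum_\sigma\phi(\sigma)\psi(\sigma)$, where $\sigma$ runs over the $i$-simplices, each with one arbitrary orientation (for $i=-1$ it is the ordinary product on $\mathbb R$). Let $\delta_i:C^i(X;\mathbb R)\to C^{i+1}(X;\mathbb R)$, $\delta_i\phi([v_0,\dots,v_{i+1}])=\sum_{j=0}^{i+1}(-1)^j\phi([v_0,\dots,\hat v_j,\dots,v_{i+1}])$, be the coboundary operator, where $\delta_{-1}$ sends $x\in\mathbb R$ to the constant function $x$ on the vertices, and let $\delta_i^*$ be its adjoint. For $i\ge0$ let $\mu_i(X)$ be the minimal eigenvalue of the reduced Laplacian $\Delta_i=\delta_{i-1}\delta_{i-1}^*+\delta_i^*\delta_i$ on $C^i(X;\mathbb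 R)$. For a simplex $\sigma$ let $\mathrm{lk}_X(\sigma)=\{\eta\in X:\sigma\cup\eta\in X,\ \sigma\cap\eta=\emptyset\}$ be its link, and for $1\le j\le k+1$ let $$D_k(X,j)=\max_{\sigma}\bigl|\{u : u\notin \mathrm{lk}_X(\sigma),\ \text{and } u\in\mathrm{lk}_X(\sigma\setminus\{v\})\text{ for exactly } j \text{ vertices } v\in\sigma\}\bigr|,$$ where $\sigma$ runs over the $k$-simplices of $X$ and $u$ over the vertices of $X$. Then $$k\,\mu_k(X)\ \ge\ (k+1)\,\mu_{k-1}(X)-n-\sum_{j=2}^{k+1}\bigl(k(k+1)+j\bigr)D_k(X,j).$$ -/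

import Mathlib

noncomputable section

namespace AbstractSimplicialComplex

variable {V : Type*}

open scoped Classical in
/-- The link of `s` in `X`: the simplices `η` of `X`, disjoint from `s`, with `s ∪ η` in `X`. -/
def link (X : AbstractSimplicialComplex V) (s : Finset V) : PreAbstractSimplicialComplex V where
  faces := {η | η ∈ X ∧ s ∪ η ∈ X ∧ Disjoint s η}
  isRelLowerSet_faces := by
    rintro η ⟨hη, hs, hd⟩
    refine ⟨(X.isRelLowerSet_faces hη).1, fun θ hθ hne => ⟨?_, ?_, ?_⟩⟩
    · exact (X.isRelLowerSet_faces hη).2 hθ hne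
    · exact (X.isRelLowerSet_faces hs).2 (Finset.union_subset_union le_rfl hθ)
        (hne.mono Finset.subset_union_right)
    · exact Finset.disjoint_of_subset_right hθ hd

open scoped Classical in
/-- `D_k(X, j)`: the maximum, over the `k`-simplices `σ` of `X`, of the number of vertices `u`
that are not in the link of `σ` but lie in the link of `σ \ {v}` for exactly `j` vertices
`v ∈ σ`. -/
def defect [Fintype V] (X : AbstractSimplicialComplex V) (k j : ℕ) : ℕ :=
  (Finset.univ.filter fun σ : Finset V => σ ∈ X ∧ σ.card = k + 1).sup fun σ =>
    (Finset.univ.filter fun u : V =>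
      {u} ∉ X.link σ ∧ (σ.filter fun v => {u} ∈ X.link (σ.erase v)).card = j).card

open scoped Classical in
/-- `t` lists, in some order and without repetition, the vertices of a simplex of `X` with `m`
vertices. For `m = 0` the empty tuple is allowed: it is the empty simplex, of dimension `-1`. -/
def IsOrderedSimplex (X : AbstractSimplicialComplex V) {m : ℕ} (t : Fin m → V) : Prop :=
  Function.Injective t ∧ (m = 0 ∨ Finset.univ.image t ∈ X)

theorem isOrderedSimplex_comp_perm (X : AbstractSimplicialComplex V) {m : ℕ} (t : Fin m → V)
    (π : Equiv.Perm (Fin m)) : X.IsOrderedSimplex (t ∘ π) ↔ X.IsOrderedSimplex t := by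
  classical
  have h : (Finset.univ.image (t ∘ π)) = Finset.univ.image t := by
    ext x
    simp only [Finset.mem_image, Finset.mem_univ, true_and, Function.comp]
    exact (π.surjective.exists (p := fun i => t i = x)).symm
  have h' : Function.Injective (t ∘ π) ↔ Function.Injective t := Equiv.injective_comp π t
  simp only [IsOrderedSimplex, h']
  convert Iff.rfl using 4
  convert h.symm

/-- The alternating real functions on the ordered simplices of `X` with `m` vertices, extended by
zero to all `m`-tuples of vertices. -/
def cochainSubmodule (X : AbstractSimplicialComplex V) (m : ℕ) :
    Submodule ℝ ((Fin m → V) → ℝ) where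
  carrier := {φ | (∀ t, ¬ X.IsOrderedSimplex t → φ t = 0) ∧
    ∀ (t : Fin m → V) (π : Equiv.Perm (Fin m)),
      φ (t ∘ π) = ((Equiv.Perm.sign π : ℤ) : ℝ) * φ t}
  add_mem' := by
    rintro φ ψ ⟨h1, h2⟩ ⟨h3, h4⟩
    refine ⟨fun t ht => by simp [h1 t ht, h3 t ht], fun t π => ?_⟩
    simp only [Pi.add_apply, h2, h4, mul_add]
  zero_mem' := ⟨fun _ _ => rfl, fun _ _ => by simp⟩
  smul_mem' := by
    rintro c φ ⟨h1, h2⟩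
    refine ⟨fun t ht => by simp [h1 t ht], fun t π => ?_⟩
    simp only [Pi.smul_apply, h2, smul_eq_mul]
    ring

/-- The space of real cochains of `X` on oriented simplices with `m` vertices, that is
`C^{m-1}(X; ℝ)`. For `m = 0` this is `C^{-1}(X; ℝ) = ℝ`. -/
def Cochain (X : AbstractSimplicialComplex V) (m : ℕ) : Type _ := X.cochainSubmodule m

namespace Cochain

instance instAddCommGroup (X : AbstractSimplicialComplex V) (m : ℕ) : AddCommGroup (X.Cochain m) :=
  inferInstanceAs (AddCommGroup (X.cochainSubmodule m))

instance instModule (X : AbstractSimplicialComplex V) (m : ℕ) : Module ℝ (X.Cochain m) :=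
  inferInstanceAs (Module ℝ (X.cochainSubmodule m))

instance instFiniteDimensional [Fintype V] (X : AbstractSimplicialComplex V) (m : ℕ) :
    FiniteDimensional ℝ (X.Cochain m) :=
  inferInstanceAs (FiniteDimensional ℝ (X.cochainSubmodule m))

instance instCoeFun (X : AbstractSimplicialComplex V) (m : ℕ) :
    CoeFun (X.Cochain m) (fun _ => (Fin m → V) → ℝ) := ⟨fun φ => φ.1⟩

/-- The standard inner product `∑ φ(σ) ψ(σ)`, summed over the simplices `σ` with `m` vertices, each
with one (arbitrary) orientation. As `φ(σ) ψ(σ)` does not depend on the ordering of `σ` and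
each `σ` has `m!` orderings, this is the sum over all `m`-tuples divided by `m!`. -/
abbrev innerCore [Fintype V] (X : AbstractSimplicialComplex V) (m : ℕ) :
    InnerProductSpace.Core ℝ (X.Cochain m) where
  inner φ ψ := (m.factorial : ℝ)⁻¹ * ∑ t : Fin m → V, φ t * ψ t
  conj_inner_symm φ ψ := by simp [mul_comm]
  re_inner_nonneg φ := by
    have : 0 ≤ (m.factorial : ℝ)⁻¹ * ∑ t : Fin m → V, φ t * φ t :=
      mul_nonneg (by positivity) (Finset.sum_nonneg fun t _ => mul_self_nonneg _)
    simpa using this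
  add_left φ ψ θ := by
    have h : ∀ t, (φ + ψ) t = φ t + ψ t := fun _ => rfl
    simp only [h, add_mul, Finset.sum_add_distrib, mul_add]
  smul_left φ ψ c := by
    have h : ∀ t, (c • φ) t = c * φ t := fun _ => rfl
    simp only [h, mul_assoc, ← Finset.mul_sum, conj_trivial]
    ring
  definite φ h := by
    have hm : (m.factorial : ℝ)⁻¹ ≠ 0 := inv_ne_zero (by exact_mod_cast Nat.factorial_ne_zero m)
    have h0 : ∑ t : Fin m → V, φ t * φ t = 0 := (mul_eq_zero.mp h).resolve_left hm
    rw [Finset.sum_eq_zero_iff_of_nonneg fun t _ => mul_self_nonneg _] at h0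
    exact Subtype.ext (funext fun t => mul_self_eq_zero.mp (h0 t (Finset.mem_univ t)))

instance instNormed [Fintype V] (X : AbstractSimplicialComplex V) (m : ℕ) :
    NormedAddCommGroup (X.Cochain m) := (innerCore X m).toNormedAddCommGroup

instance instInner [Fintype V] (X : AbstractSimplicialComplex V) (m : ℕ) :
    InnerProductSpace ℝ (X.Cochain m) := InnerProductSpace.ofCore (innerCore X m).toCore

end Cochain

/-- A permutation `π` restricts to a bijection from the indices other than `j` to those other than
`π j`; this is its sign in terms of the sign of `π`. -/
theorem exists_perm_succAbove {m : ℕ} (π : Equiv.Perm (Fin (m + 1))) (j : Fin (m + 1)) :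
    ∃ τ : Equiv.Perm (Fin m), (∀ i, π (j.succAbove i) = (π j).succAbove (τ i)) ∧
      ((-1 : ℝ) ^ (j : ℕ)) * ((Equiv.Perm.sign τ : ℤ) : ℝ) =
        ((Equiv.Perm.sign π : ℤ) : ℝ) * (-1) ^ ((π j : Fin (m + 1)) : ℕ) := by
  set ρ : Equiv.Perm (Fin (m + 1)) := (π j).cycleRange * π * j.cycleRange⁻¹ with hρ
  obtain ⟨⟨p, τ⟩, hτ⟩ := (Equiv.Perm.decomposeFin (n := m)).symm.surjective ρ
  have h0 : ρ 0 = 0 := by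
    have : j.cycleRange⁻¹ 0 = j := by
      rw [Equiv.Perm.inv_eq_iff_eq, Fin.cycleRange_self]
    simp [hρ, Fin.cycleRange_self]
  have hp : p = 0 := by
    rw [← hτ] at h0
    simpa using h0
  subst hp
  refine ⟨τ, fun i => ?_, ?_⟩
  · have h1 : ρ i.succ = (τ i).succ := by
      rw [← hτ]; simp
    have h2 : j.cycleRange⁻¹ i.succ = j.succAbove i := Fin.cycleRange_symm_succ j i
    simp only [hρ, Equiv.Perm.mul_apply, h2] at h1
    rw [← Fin.cycleRange_symm_succ (π j), ← h1, Equiv.symm_apply_apply]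
  · have h1 : Equiv.Perm.sign τ = Equiv.Perm.sign ρ := by
      rw [← hτ]; simp [Equiv.Perm.decomposeFin.symm_sign]
    rw [h1, hρ]
    simp only [Equiv.Perm.sign_mul, Equiv.Perm.sign_inv, Fin.sign_cycleRange]
    push_cast
    have h2 : ((-1 : ℝ) ^ (j : ℕ)) * (-1) ^ (j : ℕ) = 1 := by
      rw [← mul_pow]; simp
    linear_combination ((-1 : ℝ) ^ ((π j : Fin (m + 1)) : ℕ) * ((Equiv.Perm.sign π : ℤ) : ℝ)) * h2

open scoped Classical in
/-- The coboundary operator `δ_{m-1} : C^{m-1}(X; ℝ) → C^m(X; ℝ)`,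
`δφ [v₀, …, v_m] = ∑ j, (-1)^j φ [v₀, …, v̂_j, …, v_m]`. For `m = 0` it sends `x ∈ ℝ` to the
constant function `x` on the vertices. -/
def coboundary (X : AbstractSimplicialComplex V) (m : ℕ) :
    X.Cochain m →ₗ[ℝ] X.Cochain (m + 1) where
  toFun φ := ⟨fun t => if X.IsOrderedSimplex t then
      ∑ j : Fin (m + 1), (-1 : ℝ) ^ (j : ℕ) * φ (t ∘ j.succAbove) else 0, by
    refine ⟨fun t ht => if_neg ht, fun t π => ?_⟩
    simp only [isOrderedSimplex_comp_perm]
    split_ifs with h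
    · rw [Finset.mul_sum, ← Equiv.sum_comp π (fun j => ((Equiv.Perm.sign π : ℤ) : ℝ) *
        ((-1 : ℝ) ^ (j : ℕ) * φ (t ∘ j.succAbove)))]
      refine Finset.sum_congr rfl fun j _ => ?_
      obtain ⟨τ, h1, h2⟩ := exists_perm_succAbove π j
      have h3 : (t ∘ π) ∘ j.succAbove = (t ∘ (π j).succAbove) ∘ τ :=
        funext fun i => congrArg t (h1 i)
      rw [h3, φ.2.2, ← mul_assoc, h2, mul_assoc]
    · simp⟩
  map_add' φ ψ := by
    refine Subtype.ext (funext fun t => ?_)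
    have h : ∀ s, (φ + ψ) s = φ s + ψ s := fun _ => rfl
    change (if X.IsOrderedSimplex t then
      ∑ j : Fin (m + 1), (-1 : ℝ) ^ (j : ℕ) * (φ + ψ) (t ∘ j.succAbove) else 0) =
      (if X.IsOrderedSimplex t then
      ∑ j : Fin (m + 1), (-1 : ℝ) ^ (j : ℕ) * φ (t ∘ j.succAbove) else 0) +
      (if X.IsOrderedSimplex t then
      ∑ j : Fin (m + 1), (-1 : ℝ) ^ (j : ℕ) * ψ (t ∘ j.succAbove) else 0)
    split_ifs
    · simp only [h, mul_add, Finset.sum_add_distrib]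
    · simp
  map_smul' c φ := by
    refine Subtype.ext (funext fun t => ?_)
    have h : ∀ s, (c • φ) s = c * φ s := fun _ => rfl
    change (if X.IsOrderedSimplex t then
      ∑ j : Fin (m + 1), (-1 : ℝ) ^ (j : ℕ) * (c • φ) (t ∘ j.succAbove) else 0) =
      c * (if X.IsOrderedSimplex t then
      ∑ j : Fin (m + 1), (-1 : ℝ) ^ (j : ℕ) * φ (t ∘ j.succAbove) else 0)
    split_ifs
    · simp only [h, Finset.mul_sum]
      exact Finset.sum_congr rfl fun j _ => by ring
    · simp

/-- The reduced Laplacian `Δ_k = δ_{k-1} δ_{k-1}^* + δ_k^* δ_k` on `C^k(X; ℝ)`, for `k ≥ 0`. -/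
def laplacian [Fintype V] (X : AbstractSimplicialComplex V) (k : ℕ) :
    X.Cochain (k + 1) →ₗ[ℝ] X.Cochain (k + 1) :=
  X.coboundary k ∘ₗ LinearMap.adjoint (X.coboundary k) +
    LinearMap.adjoint (X.coboundary (k + 1)) ∘ₗ X.coboundary (k + 1)

/-- `μ_k(X)`, the minimal eigenvalue of the Laplacian `Δ_k`. It is meaningful when `X` has a
`k`-simplex, see `isLeast_minEigenvalue`. -/
def minEigenvalue [Fintype V] (X : AbstractSimplicialComplex V) (k : ℕ) : ℝ :=
  sInf {a : ℝ | Module.End.HasEigenvalue (X.laplacian k) a}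

theorem laplacian_isSymmetric [Fintype V] (X : AbstractSimplicialComplex V) (k : ℕ) :
    (X.laplacian k).IsSymmetric := by
  intro φ ψ
  simp only [laplacian, LinearMap.add_apply, LinearMap.comp_apply, inner_add_left, inner_add_right,
    LinearMap.adjoint_inner_left, LinearMap.adjoint_inner_right]
  rw [← LinearMap.adjoint_inner_right, ← LinearMap.adjoint_inner_left (X.coboundary k)]

/-- If `X` has a `k`-simplex, then there are non-zero `k`-cochains. -/
theorem nontrivial_cochain (X : AbstractSimplicialComplex V) (k : ℕ)
    (hX : ∃ σ ∈ X, σ.card = k + 1) : Nontrivial (X.Cochain (k + 1)) := by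
  classical
  obtain ⟨σ, hσ, hc⟩ := hX
  set e := σ.equivFinOfCardEq hc
  set t : Fin (k + 1) → V := fun i => (e.symm i : V) with ht
  have hinj : Function.Injective t := Subtype.val_injective.comp e.symm.injective
  have himg : Finset.univ.image t = σ := by
    ext x
    simp only [Finset.mem_image, Finset.mem_univ, true_and]
    exact ⟨fun ⟨i, hi⟩ => hi ▸ (e.symm i).2, fun hx => ⟨e ⟨x, hx⟩, by simp [ht]⟩⟩
  have hts : X.IsOrderedSimplex t := ⟨hinj, Or.inr (by convert hσ)⟩
  let φ : X.Cochain (k + 1) := ⟨fun s => ∑ π : Equiv.Perm (Fin (k + 1)),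
      if s = t ∘ π then ((Equiv.Perm.sign π : ℤ) : ℝ) else 0, by
    refine ⟨fun s hs => Finset.sum_eq_zero fun π _ => if_neg ?_, fun s π => ?_⟩
    · rintro rfl
      exact hs ((isOrderedSimplex_comp_perm X t π).2 hts)
    · beta_reduce
      rw [Finset.mul_sum, ← Equiv.sum_comp (Equiv.mulRight π) (fun ρ : Equiv.Perm (Fin (k + 1)) =>
        if s ∘ π = t ∘ ρ then ((Equiv.Perm.sign ρ : ℤ) : ℝ) else 0)]
      refine Finset.sum_congr rfl fun ρ _ => ?_
      have h : s ∘ π = t ∘ (ρ * π : Equiv.Perm _) ↔ s = t ∘ ρ := by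
        rw [Equiv.Perm.coe_mul, ← Function.comp_assoc]
        exact π.surjective.injective_comp_right.eq_iff
      simp only [Equiv.coe_mulRight, h, Equiv.Perm.sign_mul]
      split_ifs
      · push_cast
        ring
      · simp⟩
  refine ⟨φ, 0, fun h => ?_⟩
  have h1 : φ t = 0 := by rw [h]; rfl
  have h2 : φ t = 1 := by
    change (∑ π : Equiv.Perm (Fin (k + 1)),
      if t = t ∘ π then ((Equiv.Perm.sign π : ℤ) : ℝ) else 0) = 1
    rw [Finset.sum_eq_single 1]
    · simp
    · intro π _ hπ
      refine if_neg fun h => hπ (Equiv.ext fun i => (hinj (congrFun h i)).symm)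
    · simp
  exact zero_ne_one (h1.symm.trans h2)

/-- If `X` has a `k`-simplex, then `μ_k(X)` is indeed the least eigenvalue of `Δ_k`. -/
theorem isLeast_minEigenvalue [Fintype V] (X : AbstractSimplicialComplex V) (k : ℕ)
    (hX : ∃ σ ∈ X, σ.card = k + 1) :
    IsLeast {a : ℝ | Module.End.HasEigenvalue (X.laplacian k) a} (X.minEigenvalue k) := by
  have := nontrivial_cochain X k hX
  have hfin : {a : ℝ | Module.End.HasEigenvalue (X.laplacian k) a}.Finite :=
    Module.End.finite_hasEigenvalue _
  have hne : {a : ℝ | Module.End.HasEigenvalue (X.laplacian k) a}.Nonempty :=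
    ⟨_, (laplacian_isSymmetric X k).hasEigenvalue_iInf_of_finiteDimensional⟩
  exact ⟨hne.csInf_mem hfin, fun a ha => csInf_le hfin.bddBelow ha⟩

end AbstractSimplicialComplex

end

/-!
The proof compares `φ` with its contractions `φ_u [v₀, …] = φ [u, v₀, …]`, one `(k - 1)`-cochain for
each vertex `u`. Let `φ` be an eigenvector of `Δ_k` for `μ_k`. The Rayleigh quotient of each `φ_u` is
at least `μ_{k-1}`, so it suffices to sum over `u` the norms of `φ_u`, `δ^* φ_u` and `δ φ_u`.

* `∑ ‖φ_u‖² = (k + 1) ‖φ‖²` (`sum_norm_contract_sq`).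
* `∑ ‖δ^* φ_u‖² = k ‖δ^* φ‖²`, since `δ^*` is the sum of all contractions, and contractions
  anticommute (`sum_norm_adjoint_contract_sq`).
* `∑ ‖δ φ_u‖² ≤ k ‖δ φ‖² + (n + ∑ j, (k (k + 1) + j) D_k(X, j)) ‖φ‖²`
  (`sum_norm_coboundary_contract_sq_le`).

For the last one, let `dφ` be the alternating sum over the facets of an arbitrary tuple of `k + 2`
vertices. Then `δ φ_u [t] = φ [t] - dφ [u, t]` on simplices `t`, and expanding the square and
symmetrizing over the position of `u` gives, up to the factor `(k + 2)!`,
`∑ ‖δ φ_u‖² = n ‖φ‖² + ∑ s, (N s - 2) (dφ s)²`, where `N s` is the number of facets of `s` in `X`.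
If `s` is a simplex, then `N s = k + 2`, and these `s` contribute `k ‖δ φ‖²`. If `s` is not, write
`N s = j + 1`; by Cauchy–Schwarz `(N s - 2) (dφ s)²` is at most `(j - 1) (j + 1)` times the sum of the
squares of `φ` over the facets of `s`. Each `k`-simplex is a facet of at most `D_k(X, j)` such sets
`s`, and `j ^ 2 - 1 ≤ k (k + 1) + j`. Sets with `j ≤ 1` contribute nothing positive.

All sums over simplices are carried out over tuples of vertices, where symmetrization is a change of
variables.
-/

noncomputable section

namespace AbstractSimplicialComplex

variable {V : Type*} {m : ℕ} {X : AbstractSimplicialComplex V}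

theorem cons_comp_succAbove_succ (u : V) (t : Fin (m + 1) → V) (i : Fin (m + 1)) :
    (Fin.cons u t : Fin (m + 2) → V) ∘ i.succ.succAbove = Fin.cons u (t ∘ i.succAbove) := by
  funext j
  refine Fin.cases ?_ (fun j => ?_) j <;> simp

/-! ### Ordered simplices -/

theorem isOrderedSimplex_succ_iff {t : Fin (m + 1) → V} [DecidableEq V] :
    X.IsOrderedSimplex t ↔ Function.Injective t ∧ Finset.univ.image t ∈ X := by
  simp only [IsOrderedSimplex, Nat.add_one_ne_zero, false_or]
  convert Iff.rfl

theorem IsOrderedSimplex.comp {n : ℕ} {t : Fin n → V} (ht : X.IsOrderedSimplex t)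
    {f : Fin m → Fin n} (hf : Function.Injective f) : X.IsOrderedSimplex (t ∘ f) := by
  classical
  rcases m with _ | m
  · exact ⟨fun i => i.elim0, Or.inl rfl⟩
  rcases n with _ | n
  · exact (f 0).elim0
  rw [isOrderedSimplex_succ_iff] at ht ⊢
  refine ⟨ht.1.comp hf, (X.isRelLowerSet_faces ht.2).2 ?_ ⟨(t ∘ f) 0, by simp⟩⟩
  intro x hx
  simp only [Finset.mem_image, Finset.mem_univ, true_and] at hx ⊢
  obtain ⟨i, rfl⟩ := hx
  exact ⟨f i, rfl⟩

open scoped Classical in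
/-- The number of facets of the tuple `s` that are ordered simplices of `X`. -/
def numFacets (X : AbstractSimplicialComplex V) (s : Fin (m + 1) → V) : ℕ :=
  (Finset.univ.filter fun i : Fin (m + 1) => X.IsOrderedSimplex (s ∘ i.succAbove)).card

theorem numFacets_comp_perm (s : Fin (m + 1) → V) (π : Equiv.Perm (Fin (m + 1))) :
    X.numFacets (s ∘ π) = X.numFacets s := by
  classical
  refine Finset.card_equiv π fun i => ?_
  obtain ⟨τ, h, -⟩ := exists_perm_succAbove π i
  have h3 : (s ∘ π) ∘ i.succAbove = (s ∘ (π i).succAbove) ∘ τ :=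
    funext fun i => congrArg s (h i)
  simp only [Finset.mem_filter, Finset.mem_univ, true_and]
  rw [h3, isOrderedSimplex_comp_perm]

theorem numFacets_le (s : Fin (m + 1) → V) : X.numFacets s ≤ m + 1 := by
  classical
  exact (Finset.card_filter_le _ _).trans (by simp)

theorem IsOrderedSimplex.numFacets_eq {s : Fin (m + 1) → V} (hs : X.IsOrderedSimplex s) :
    X.numFacets s = m + 1 := by
  classical
  rw [numFacets, Finset.filter_true_of_mem fun i _ => hs.comp Fin.succAbove_right_injective]
  simp

/-! ### Sums over tuples -/

/-- Precomposing tuples with the cycle `j.cycleRange` moves the omitted index `j` to `0`. -/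
theorem sum_comp_succAbove [Fintype V] (j : Fin (m + 1))
    (F : (Fin m → V) → (Fin (m + 1) → V) → ℝ) :
    ∑ s, F (s ∘ j.succAbove) s = ∑ s, F (s ∘ Fin.succ) (s ∘ j.cycleRange) := by
  rw [← Equiv.sum_comp (Equiv.arrowCongr j.cycleRange.symm (Equiv.refl V))]
  refine Finset.sum_congr rfl fun s _ => ?_
  have h : (s ∘ j.cycleRange) ∘ j.succAbove = s ∘ Fin.succ :=
    funext fun i => by simp
  exact congrArg₂ F h rfl

/-- Against a symmetric function, all `m + 1` facets contribute equally. -/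
theorem sum_sum_comp_succAbove [Fintype V] (A : (Fin (m + 1) → V) → ℝ)
    (hA : ∀ s (π : Equiv.Perm (Fin (m + 1))), A (s ∘ π) = A s) (f : (Fin m → V) → ℝ) :
    ∑ s, A s * ∑ j : Fin (m + 1), f (s ∘ j.succAbove) =
      (m + 1 : ℝ) * ∑ s, A s * f (s ∘ Fin.succ) := by
  simp only [Finset.mul_sum]
  rw [Finset.sum_comm]
  simp only [sum_comp_succAbove _ (fun t s => A s * f t), hA]
  simp [← Finset.mul_sum]

theorem sum_tuple_succ [Fintype V] (f : (Fin (m + 1) → V) → ℝ) :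
    ∑ s, f s = ∑ u : V, ∑ t : Fin m → V, f (Fin.cons u t) := by
  rw [← Fintype.sum_prod_type', ← Equiv.sum_comp (Fin.consEquiv fun _ => V)]
  rfl

/-! ### The coboundary on arbitrary tuples -/

/-- The alternating sum over all facets of a tuple `s`, whether or not `s` is a simplex. On ordered
simplices it is the coboundary. -/
def fullCoboundary (f : (Fin m → V) → ℝ) (s : Fin (m + 1) → V) : ℝ :=
  ∑ j : Fin (m + 1), (-1 : ℝ) ^ (j : ℕ) * f (s ∘ j.succAbove)

theorem fullCoboundary_comp_perm (φ : X.Cochain m) (s : Fin (m + 1) → V)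
    (π : Equiv.Perm (Fin (m + 1))) :
    fullCoboundary φ (s ∘ π) = ((Equiv.Perm.sign π : ℤ) : ℝ) * fullCoboundary φ s := by
  unfold fullCoboundary
  rw [Finset.mul_sum, ← Equiv.sum_comp π (fun j => ((Equiv.Perm.sign π : ℤ) : ℝ) *
    ((-1 : ℝ) ^ (j : ℕ) * φ (s ∘ j.succAbove)))]
  refine Finset.sum_congr rfl fun j _ => ?_
  obtain ⟨τ, h1, h2⟩ := exists_perm_succAbove π j
  have h3 : (s ∘ π) ∘ j.succAbove = (s ∘ (π j).succAbove) ∘ τ :=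
    funext fun i => congrArg s (h1 i)
  rw [h3, φ.2.2, ← mul_assoc, h2, mul_assoc]

theorem sign_mul_self (π : Equiv.Perm (Fin m)) :
    ((Equiv.Perm.sign π : ℤ) : ℝ) * ((Equiv.Perm.sign π : ℤ) : ℝ) = 1 := by
  rw [← Int.cast_mul, ← Units.val_mul, Int.units_mul_self]
  simp

theorem fullCoboundary_sq_comp_perm (φ : X.Cochain m) (s : Fin (m + 1) → V)
    (π : Equiv.Perm (Fin (m + 1))) :
    fullCoboundary φ (s ∘ π) ^ 2 = fullCoboundary φ s ^ 2 := by
  rw [fullCoboundary_comp_perm]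
  linear_combination fullCoboundary φ s ^ 2 * sign_mul_self π

theorem fullCoboundary_eq_zero_of_not_injective (φ : X.Cochain m) {s : Fin (m + 1) → V}
    (hs : ¬ Function.Injective s) : fullCoboundary φ s = 0 := by
  simp only [Function.Injective, not_forall] at hs
  obtain ⟨a, b, hab, hne⟩ := hs
  have h := fullCoboundary_comp_perm φ s (Equiv.swap a b)
  -- Swapping two equal entries changes nothing, but reverses the sign.
  have h2 : s ∘ Equiv.swap a b = s := by
    funext i
    rcases eq_or_ne i a with rfl | ha
    · simp [hab]
    rcases eq_or_ne i b with rfl | hb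
    · simp [hab]
    simp [Equiv.swap_apply_of_ne_of_ne ha hb]
  rw [h2, Equiv.Perm.sign_swap hne] at h
  push_cast at h
  linarith

open scoped Classical in
theorem coboundary_apply (φ : X.Cochain m) (s : Fin (m + 1) → V) :
    X.coboundary m φ s = if X.IsOrderedSimplex s then fullCoboundary φ s else 0 := rfl

/-- The cone formula `dφ [u, t] = φ [t] - d(φ_u) [t]`, valid on all tuples. -/
theorem fullCoboundary_cons (f : (Fin (m + 1) → V) → ℝ) (u : V) (t : Fin (m + 1) → V) :
    fullCoboundary f (Fin.cons u t) =
      f t - fullCoboundary (fun r : Fin m → V => f (Fin.cons u r)) t := by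
  unfold fullCoboundary
  rw [Fin.sum_univ_succ]
  simp only [cons_comp_succAbove_succ, Fin.val_succ, pow_succ, Fin.val_zero, pow_zero, one_mul,
    mul_neg, mul_one, neg_mul, Finset.sum_neg_distrib, sub_eq_add_neg]
  congr 1

/-- Only the facets in `X` contribute to `fullCoboundary`, so Cauchy–Schwarz gives the factor
`numFacets`. -/
theorem fullCoboundary_sq_le (φ : X.Cochain m) (s : Fin (m + 1) → V) :
    fullCoboundary φ s ^ 2 ≤
      X.numFacets s * ∑ j : Fin (m + 1), φ (s ∘ j.succAbove) ^ 2 := by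
  classical
  have h : fullCoboundary φ s = ∑ j ∈ Finset.univ.filter fun i : Fin (m + 1) =>
      X.IsOrderedSimplex (s ∘ i.succAbove), (-1 : ℝ) ^ (j : ℕ) * φ (s ∘ j.succAbove) := by
    rw [fullCoboundary, Finset.sum_filter_of_ne]
    intro j _ hj
    by_contra hc
    exact hj (by rw [φ.2.1 _ hc, mul_zero])
  rw [h]
  refine sq_sum_le_card_mul_sum_sq.trans ?_
  refine mul_le_mul_of_nonneg_left ?_ (Nat.cast_nonneg _)
  simp only [mul_pow, ← pow_mul, mul_comm _ 2, pow_mul (-1 : ℝ) 2, neg_one_sq, one_pow, one_mul]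
  exact Finset.sum_le_sum_of_subset_of_nonneg (Finset.subset_univ _) fun _ _ _ => sq_nonneg _

/-- Against an alternating function, all `m + 1` terms of `fullCoboundary` contribute equally: the
sign of the cycle that moves `j` to `0` is `(-1) ^ j`. -/
theorem sum_fullCoboundary_mul [Fintype V] (f : (Fin m → V) → ℝ) (A : (Fin (m + 1) → V) → ℝ)
    (hA : ∀ s (π : Equiv.Perm (Fin (m + 1))),
      A (s ∘ π) = ((Equiv.Perm.sign π : ℤ) : ℝ) * A s) :
    ∑ s, fullCoboundary f s * A s = (m + 1 : ℝ) * ∑ s, f (s ∘ Fin.succ) * A s := by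
  simp only [fullCoboundary, Finset.sum_mul]
  rw [Finset.sum_comm]
  have h3 : ∀ j : Fin (m + 1), ∑ s : Fin (m + 1) → V,
      (-1 : ℝ) ^ (j : ℕ) * f (s ∘ j.succAbove) * A s = ∑ s, f (s ∘ Fin.succ) * A s := by
    intro j
    rw [sum_comp_succAbove j fun t s => (-1 : ℝ) ^ (j : ℕ) * f t * A s]
    refine Finset.sum_congr rfl fun s _ => ?_
    rw [hA, Fin.sign_cycleRange]
    have h4 : ((-1 : ℝ) ^ (j : ℕ)) * (-1) ^ (j : ℕ) = 1 := by rw [← mul_pow]; simp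
    push_cast
    linear_combination f (s ∘ Fin.succ) * A s * h4
  simp [h3]

/-! ### Contraction and the adjoint of the coboundary -/

/-- The contraction of a cochain `φ` with a vertex `u`, `φ_u [v₀, …] = φ [u, v₀, …]`. It is supported
on the link of `u`, because `φ` vanishes on tuples that are not ordered simplices. -/
def contract (φ : X.Cochain (m + 1)) (u : V) : X.Cochain m :=
  ⟨fun t => φ (Fin.cons u t), by
    refine ⟨fun t ht => φ.2.1 _ fun h => ht ?_, fun t π => ?_⟩
    · simpa [Fin.cons_comp_succ] using h.comp (Fin.succ_injective m)
    · have h : (Fin.cons u (t ∘ π) : Fin (m + 1) → V) =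
          Fin.cons u t ∘ Equiv.Perm.decomposeFin.symm (0, π) := by
        funext i
        refine Fin.cases ?_ (fun i => ?_) i <;> simp
      beta_reduce
      rw [h, φ.2.2]
      simp [Equiv.Perm.decomposeFin.symm_sign]⟩

theorem contract_apply (φ : X.Cochain (m + 1)) (u : V) (t : Fin m → V) :
    contract φ u t = φ (Fin.cons u t) := rfl

theorem inner_eq [Fintype V] (φ ψ : X.Cochain m) :
    inner ℝ φ ψ = (m.factorial : ℝ)⁻¹ * ∑ t : Fin m → V, φ t * ψ t := rfl

theorem factorial_mul_norm_sq [Fintype V] (φ : X.Cochain m) :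
    (m.factorial : ℝ) * ‖φ‖ ^ 2 = ∑ t : Fin m → V, φ t ^ 2 := by
  have hm : (m.factorial : ℝ) ≠ 0 := by exact_mod_cast Nat.factorial_ne_zero m
  rw [← real_inner_self_eq_norm_sq, inner_eq, mul_inv_cancel_left₀ hm]
  simp only [sq]

theorem sum_norm_contract_sq [Fintype V] (φ : X.Cochain (m + 1)) :
    ∑ u, ‖contract φ u‖ ^ 2 = (m + 1 : ℝ) * ‖φ‖ ^ 2 := by
  have hm : (m.factorial : ℝ) ≠ 0 := by exact_mod_cast Nat.factorial_ne_zero m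
  refine mul_left_cancel₀ hm ?_
  rw [Finset.mul_sum]
  simp only [factorial_mul_norm_sq, contract_apply]
  rw [← sum_tuple_succ fun s => φ s ^ 2, ← factorial_mul_norm_sq, Nat.factorial_succ]
  push_cast
  ring

theorem sum_cochain_apply {ι : Type*} (s : Finset ι) (f : ι → X.Cochain m) (t : Fin m → V) :
    (∑ i ∈ s, f i : X.Cochain m) t = ∑ i ∈ s, f i t :=
  map_sum ((LinearMap.proj t : ((Fin m → V) → ℝ) →ₗ[ℝ] ℝ) ∘ₗ (X.cochainSubmodule m).subtype) f s

/-- `δ^* φ = ∑ u, φ_u`. -/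
theorem adjoint_coboundary_apply [Fintype V] (ψ : X.Cochain (m + 1)) :
    LinearMap.adjoint (X.coboundary m) ψ = ∑ u, contract ψ u := by
  refine ext_inner_left ℝ fun φ => ?_
  rw [LinearMap.adjoint_inner_right, inner_eq, inner_eq]
  have h1 : ∀ s : Fin (m + 1) → V, X.coboundary m φ s * ψ s = fullCoboundary φ s * ψ s := by
    intro s
    rw [coboundary_apply]
    split_ifs with h
    · rfl
    · rw [ψ.2.1 s h, mul_zero, mul_zero]
  simp only [h1, sum_fullCoboundary_mul φ ψ ψ.2.2, sum_cochain_apply, contract_apply, Finset.mul_sum]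
  rw [sum_tuple_succ, Finset.sum_comm]
  refine Finset.sum_congr rfl fun t _ => Finset.sum_congr rfl fun u _ => ?_
  have hm : (m.factorial : ℝ) ≠ 0 := by exact_mod_cast Nat.factorial_ne_zero m
  rw [Nat.factorial_succ, Fin.cons_comp_succ]
  push_cast
  field_simp

theorem contract_contract (φ : X.Cochain (m + 2)) (u v : V) :
    contract (contract φ u) v = - contract (contract φ v) u := by
  refine Subtype.ext (funext fun t => ?_)
  change φ (Fin.cons u (Fin.cons v t)) = - φ (Fin.cons v (Fin.cons u t))
  have h : (Fin.cons u (Fin.cons v t) : Fin (m + 2) → V) =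
      Fin.cons v (Fin.cons u t) ∘ Equiv.swap 0 1 := by
    funext i
    refine Fin.cases (by simp) (fun i => Fin.cases (by simp) (fun i => ?_) i) i
    have h1 : Equiv.swap (0 : Fin (m + 2)) 1 i.succ.succ = i.succ.succ :=
      Equiv.swap_apply_of_ne_of_ne (Fin.succ_ne_zero _)
        fun h => Fin.succ_ne_zero i (Fin.succ_injective _ h)
    simp [h1]
  rw [h, φ.2.2, Equiv.Perm.sign_swap (by simp)]
  simp

theorem contract_sum {ι : Type*} (s : Finset ι) (f : ι → X.Cochain (m + 1)) (u : V) :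
    contract (∑ i ∈ s, f i) u = ∑ i ∈ s, contract (f i) u := by
  refine Subtype.ext (funext fun t => ?_)
  exact (sum_cochain_apply s f (Fin.cons u t)).trans (sum_cochain_apply s (fun i => contract (f i) u) t).symm

/-- Contractions anticommute, so `δ^* (φ_u) = -(δ^* φ)_u`. -/
theorem sum_norm_adjoint_contract_sq [Fintype V] (φ : X.Cochain (m + 2)) :
    ∑ u, ‖LinearMap.adjoint (X.coboundary m) (contract φ u)‖ ^ 2 =
      (m + 1 : ℝ) * ‖LinearMap.adjoint (X.coboundary (m + 1)) φ‖ ^ 2 := by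
  rw [← sum_norm_contract_sq]
  refine Finset.sum_congr rfl fun u _ => ?_
  rw [adjoint_coboundary_apply, adjoint_coboundary_apply, contract_sum]
  simp only [contract_contract φ u]
  rw [Finset.sum_neg_distrib, norm_neg]

/-! ### Rayleigh quotients -/

theorem inner_laplacian_self [Fintype V] (k : ℕ) (φ : X.Cochain (k + 1)) :
    inner ℝ (X.laplacian k φ) φ =
      ‖LinearMap.adjoint (X.coboundary k) φ‖ ^ 2 + ‖X.coboundary (k + 1) φ‖ ^ 2 := by
  rw [laplacian, LinearMap.add_apply, inner_add_left, LinearMap.comp_apply, LinearMap.comp_apply,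
    LinearMap.adjoint_inner_left, ← LinearMap.adjoint_inner_right, real_inner_self_eq_norm_sq,
    real_inner_self_eq_norm_sq]

theorem minEigenvalue_mul_norm_sq_le [Fintype V] (k : ℕ) (hX : ∃ σ ∈ X, σ.card = k + 1)
    (φ : X.Cochain (k + 1)) :
    X.minEigenvalue k * ‖φ‖ ^ 2 ≤ inner ℝ (X.laplacian k φ) φ := by
  -- Expand in an orthonormal basis of eigenvectors.
  have hT := laplacian_isSymmetric X k
  set b := hT.eigenvectorBasis rfl with hb
  rw [← b.sum_inner_mul_inner (X.laplacian k φ) φ, ← real_inner_self_eq_norm_sq,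
    ← b.sum_inner_mul_inner φ φ, Finset.mul_sum]
  refine Finset.sum_le_sum fun i _ => ?_
  have h1 : inner ℝ (X.laplacian k φ) (b i) = hT.eigenvalues rfl i * inner ℝ φ (b i) := by
    rw [hT φ (b i), hb, hT.apply_eigenvectorBasis rfl i, inner_smul_right]
    rfl
  rw [h1, mul_assoc]
  refine mul_le_mul_of_nonneg_right ?_ ?_
  · exact (isLeast_minEigenvalue X k hX).2 (hT.hasEigenvalue_eigenvalues rfl i)
  · rw [real_inner_comm φ (b i)]
    exact mul_self_nonneg _

/-! ### Tuples that are not simplices -/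

open scoped Classical in
/-- `j ^ 2 - 1` for a tuple `s` of distinct vertices that do not form a simplex of `X` and of which
`j + 1` facets are in `X`, when `2 ≤ j`; and `0` for all other tuples. -/
def defectWeight (X : AbstractSimplicialComplex V) (s : Fin (m + 1) → V) : ℝ :=
  if Function.Injective s ∧ ¬ X.IsOrderedSimplex s ∧ 3 ≤ X.numFacets s then
    (X.numFacets s - 2) * X.numFacets s else 0

theorem defectWeight_nonneg (s : Fin (m + 1) → V) : 0 ≤ X.defectWeight s := by
  unfold defectWeight
  split_ifs with h
  · have : (3 : ℝ) ≤ X.numFacets s := by exact_mod_cast h.2.2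
    exact mul_nonneg (by linarith) (by linarith)
  · exact le_rfl

theorem defectWeight_comp_perm (s : Fin (m + 1) → V) (π : Equiv.Perm (Fin (m + 1))) :
    X.defectWeight (s ∘ π) = X.defectWeight s := by
  unfold defectWeight
  have h : Function.Injective (s ∘ π) ↔ Function.Injective s := Equiv.injective_comp π s
  rw [numFacets_comp_perm]
  congr 1
  rw [h, isOrderedSimplex_comp_perm]

/-- The pointwise estimate of the summand in `sum_norm_coboundary_contract_sq`. If `s` is a simplex,
all `m + 2` facets are in `X`, and equality holds without the second term; otherwise this is
Cauchy–Schwarz, and at most two facets in `X` give a non-positive left-hand side. -/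
theorem mul_fullCoboundary_sq_le (φ : X.Cochain (m + 1)) (s : Fin (m + 2) → V) :
    ((X.numFacets s : ℝ) - 2) * fullCoboundary φ s ^ 2 ≤
      m * (X.coboundary (m + 1) φ s) ^ 2 +
        X.defectWeight s * ∑ j : Fin (m + 2), φ (s ∘ j.succAbove) ^ 2 := by
  have hS : 0 ≤ ∑ j : Fin (m + 2), φ (s ∘ j.succAbove) ^ 2 :=
    Finset.sum_nonneg fun _ _ => sq_nonneg _
  have hw := mul_nonneg (X.defectWeight_nonneg s) hS
  by_cases hs : X.IsOrderedSimplex s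
  · rw [coboundary_apply, if_pos hs, hs.numFacets_eq]
    push_cast
    linarith
  rw [coboundary_apply, if_neg hs]
  by_cases hi : Function.Injective s
  · by_cases h3 : 3 ≤ X.numFacets s
    · have : (3 : ℝ) ≤ X.numFacets s := by exact_mod_cast h3
      have h := mul_le_mul_of_nonneg_left (fullCoboundary_sq_le φ s)
        (by linarith : 0 ≤ (X.numFacets s : ℝ) - 2)
      rw [defectWeight, if_pos ⟨hi, hs, h3⟩]
      linarith
    · have : (X.numFacets s : ℝ) ≤ 2 := by exact_mod_cast (by omega : X.numFacets s ≤ 2)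
      have := mul_nonneg (by linarith : 0 ≤ 2 - (X.numFacets s : ℝ))
        (sq_nonneg (fullCoboundary φ s))
      linarith
  · rw [fullCoboundary_eq_zero_of_not_injective φ hi]
    linarith

open scoped Classical in
/-- The set of vertices that `defect` counts, for the simplex `σ`. -/
def defectSet [Fintype V] (X : AbstractSimplicialComplex V) (σ : Finset V) (j : ℕ) : Finset V :=
  Finset.univ.filter fun u : V =>
    {u} ∉ X.link σ ∧ (σ.filter fun v => {u} ∈ X.link (σ.erase v)).card = j

theorem card_defectSet_le [Fintype V] {σ : Finset V} {k : ℕ} (hσ : σ ∈ X)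
    (hk : σ.card = k + 1) (j : ℕ) : (X.defectSet σ j).card ≤ X.defect k j := by
  classical
  unfold defect
  exact Finset.le_sup (f := fun σ => (X.defectSet σ j).card) (by simp [hσ, hk])

/-- `u` is in the link of a simplex if and only if it extends each ordering of it to an ordered
simplex. As `t` may be empty, it is not assumed to be a simplex. -/
theorem isOrderedSimplex_cons_iff [DecidableEq V] {u : V} {t : Fin m → V}
    (ht : Function.Injective t) (hu : u ∉ Set.range t) :
    X.IsOrderedSimplex (Fin.cons u t : Fin (m + 1) → V) ↔
      {u} ∈ X.link (Finset.univ.image t) := by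
  have h : Finset.univ.image (Fin.cons u t : Fin (m + 1) → V) = Finset.univ.image t ∪ {u} := by
    ext x
    simp [Fin.exists_fin_succ, eq_comm]
  have hl : {u} ∈ X.link (Finset.univ.image t) ↔ {u} ∈ X ∧ Finset.univ.image t ∪ {u} ∈ X ∧
      Disjoint (Finset.univ.image t) {u} := by
    rw [show Finset.univ.image t ∪ {u} = @Union.union _
      (@Finset.instUnion _ fun a b => Classical.propDecidable (a = b)) (Finset.univ.image t) {u} by
        congr!]
    exact Iff.rfl
  rw [isOrderedSimplex_succ_iff, Fin.cons_injective_iff, h, hl]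
  refine ⟨fun h => ⟨(X.isRelLowerSet_faces h.2).2 ?_ (by simp), h.2, ?_⟩,
    fun h => ⟨⟨hu, ht⟩, h.2.1⟩⟩
  · exact Finset.subset_union_right
  · simpa using hu

/-- Apart from `t` itself, the facets of `(u, t)` in `X` are those obtained by replacing a vertex `v`
of `t` by `u`, where `u` is in the link of `t` without `v`. -/
theorem numFacets_cons [DecidableEq V] {u : V} {t : Fin (m + 1) → V}
    (ht : X.IsOrderedSimplex t) (hu : u ∉ Set.range t)
    [DecidablePred fun v => {u} ∈ X.link ((Finset.univ.image t).erase v)] :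
    X.numFacets (Fin.cons u t : Fin (m + 2) → V) =
      ((Finset.univ.image t).filter
        fun v => {u} ∈ X.link ((Finset.univ.image t).erase v)).card + 1 := by
  classical
  rw [numFacets, Fin.card_filter_univ_succ, Finset.filter_image,
    Finset.card_image_of_injective _ ht.1, if_pos]
  · congr 2
    refine Finset.filter_congr fun i _ => ?_
    rw [cons_comp_succAbove_succ, isOrderedSimplex_cons_iff]
    · have : Finset.univ.image (t ∘ i.succAbove) = (Finset.univ.image t).erase (t i) := by
        ext x
        simp only [Finset.mem_image, Finset.mem_univ, true_and, Finset.mem_erase,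
          Function.comp_apply]
        constructor
        · rintro ⟨j, rfl⟩
          exact ⟨fun h => Fin.succAbove_ne i j (ht.1 h), _, rfl⟩
        · rintro ⟨hx, j, rfl⟩
          obtain ⟨l, rfl⟩ := Fin.exists_succAbove_eq (x := j) (y := i) fun h => hx (h ▸ rfl)
          exact ⟨l, rfl⟩
      rw [this]
    · exact ht.1.comp Fin.succAbove_right_injective
    · rintro ⟨j, rfl⟩
      exact hu ⟨_, rfl⟩
  · simpa [Fin.cons_comp_succ] using ht

theorem defectWeight_cons_le [Fintype V] {t : Fin (m + 1) → V} [DecidableEq V]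
    (ht : X.IsOrderedSimplex t) (u : V) :
    X.defectWeight (Fin.cons u t : Fin (m + 2) → V) ≤ ∑ j ∈ Finset.Icc 2 (m + 1),
      ((m : ℝ) * (m + 1) + j) * if u ∈ X.defectSet (Finset.univ.image t) j then 1 else 0 := by
  have hnn : ∀ j ∈ Finset.Icc 2 (m + 1), (0 : ℝ) ≤ ((m : ℝ) * (m + 1) + j) *
      if u ∈ X.defectSet (Finset.univ.image t) j then 1 else 0 := by
    intro j _
    split_ifs <;> positivity
  rw [defectWeight]
  split_ifs with h
  · obtain ⟨hi, hs, h3⟩ := h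
    have hu := (Fin.cons_injective_iff.1 hi).1
    have hle := X.numFacets_le (Fin.cons u t : Fin (m + 2) → V)
    obtain ⟨j, hj⟩ : ∃ j, X.numFacets (Fin.cons u t : Fin (m + 2) → V) = j + 1 :=
      ⟨_, (Nat.sub_add_cancel (by omega)).symm⟩
    have hmem : u ∈ X.defectSet (Finset.univ.image t) j := by
      classical
      have h1 := numFacets_cons ht hu
      rw [hj, add_left_inj] at h1
      rw [defectSet, Finset.mem_filter, ← isOrderedSimplex_cons_iff ht.1 hu]
      refine ⟨Finset.mem_univ _, hs, ?_⟩
      rw [h1]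
      congr!
    refine le_trans ?_ (Finset.single_le_sum hnn (Finset.mem_Icc.2 ⟨by omega, by omega⟩ :
      j ∈ Finset.Icc 2 (m + 1)))
    rw [if_pos hmem, hj]
    have : (j : ℝ) ≤ m + 1 := by exact_mod_cast (by omega : j ≤ m + 1)
    have h2 : (2 : ℝ) ≤ j := by exact_mod_cast (by omega : 2 ≤ j)
    push_cast
    -- `j ^ 2 - 1 ≤ m * (m + 1) + j`, because `j * (j - 1) ≤ (m + 1) * m`.
    nlinarith
  · exact Finset.sum_nonneg hnn

theorem sum_defectWeight_cons_le [Fintype V] {t : Fin (m + 1) → V} (ht : X.IsOrderedSimplex t) :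
    ∑ u, X.defectWeight (Fin.cons u t : Fin (m + 2) → V) ≤ ∑ j ∈ Finset.Icc 2 (m + 1),
      ((m : ℝ) * (m + 1) + j) * X.defect m j := by
  classical
  refine (Finset.sum_le_sum fun u _ => defectWeight_cons_le ht u).trans ?_
  rw [Finset.sum_comm]
  refine Finset.sum_le_sum fun j _ => ?_
  rw [← Finset.mul_sum, Finset.sum_boole]
  refine mul_le_mul_of_nonneg_left ?_ (by positivity)
  simp only [Finset.filter_univ_mem]
  refine Nat.cast_le.2 (card_defectSet_le (isOrderedSimplex_succ_iff.1 ht).2 ?_ j)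
  rw [Finset.card_image_of_injective _ ht.1]
  simp

/-! ### The coboundaries of the contractions -/

/-- By `fullCoboundary_cons`, `δ(φ_u) [t] = φ [t] - dφ [u, t]` for each ordered simplex `t`. In the
square, the first terms sum to `|V| ‖φ‖²`. Averaging the others over the position of `u` in the
`(m + 2)`-tuple turns them into `numFacets` copies of `(dφ)²` from the squares, minus two copies
from the mixed terms. -/
theorem sum_norm_coboundary_contract_sq [Fintype V] (φ : X.Cochain (m + 1)) :
    ((m + 2).factorial : ℝ) * ∑ u, ‖X.coboundary m (contract φ u)‖ ^ 2 =
      (m + 2).factorial * (Fintype.card V * ‖φ‖ ^ 2) +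
        ∑ s : Fin (m + 2) → V, ((X.numFacets s : ℝ) - 2) * fullCoboundary φ s ^ 2 := by
  classical
  -- The indicator function of the ordered simplices.
  let I : (Fin (m + 1) → V) → ℝ := fun t => if X.IsOrderedSimplex t then 1 else 0
  have h1 : ((m + 1).factorial : ℝ) * ∑ u, ‖X.coboundary m (contract φ u)‖ ^ 2 =
      ∑ u, ∑ t : Fin (m + 1) → V, (φ t ^ 2 + (fullCoboundary φ (Fin.cons u t) ^ 2 * I t -
        2 * (φ t * fullCoboundary φ (Fin.cons u t)))) := by
    rw [Finset.mul_sum]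
    refine Finset.sum_congr rfl fun u _ => ?_
    rw [factorial_mul_norm_sq]
    refine Finset.sum_congr rfl fun t _ => ?_
    rw [coboundary_apply, fullCoboundary_cons]
    simp only [I]
    split_ifs with ht
    · change fullCoboundary (fun r : Fin m → V => φ (Fin.cons u r)) t ^ 2 = _
      ring
    · rw [φ.2.1 t ht]
      ring
  have h2 : ∑ s : Fin (m + 2) → V, fullCoboundary φ s ^ 2 * I (s ∘ Fin.succ) * (m + 2) =
      ∑ s : Fin (m + 2) → V, fullCoboundary φ s ^ 2 * X.numFacets s := by
    have h := sum_sum_comp_succAbove (fun s => fullCoboundary φ s ^ 2)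
      (fullCoboundary_sq_comp_perm φ) I
    rw [← Finset.sum_mul]
    simp only [I, Finset.sum_boole] at h ⊢
    push_cast at h
    have h' : ∑ s : Fin (m + 2) → V, fullCoboundary φ s ^ 2 * (X.numFacets s : ℝ) = _ := h
    rw [h']
    ring
  have h3 := sum_fullCoboundary_mul (φ : (Fin (m + 1) → V) → ℝ) (fullCoboundary φ)
    (fullCoboundary_comp_perm φ)
  have h4 : ∑ u : V, ∑ t : Fin (m + 1) → V, (φ t ^ 2 + (fullCoboundary φ (Fin.cons u t) ^ 2 * I t -
        2 * (φ t * fullCoboundary φ (Fin.cons u t)))) =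
      Fintype.card V * ((m + 1).factorial * ‖φ‖ ^ 2) +
      (∑ s : Fin (m + 2) → V, fullCoboundary φ s ^ 2 * I (s ∘ Fin.succ) -
        2 * ∑ s : Fin (m + 2) → V, φ (s ∘ Fin.succ) * fullCoboundary φ s) := by
    rw [sum_tuple_succ, sum_tuple_succ, factorial_mul_norm_sq]
    simp only [Fin.cons_comp_succ, Finset.sum_add_distrib, Finset.sum_sub_distrib, Finset.mul_sum]
    simp [Finset.mul_sum]
  rw [h4] at h1
  rw [← Finset.sum_mul] at h2
  simp only [sub_mul, Finset.sum_sub_distrib]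
  simp only [← Finset.mul_sum, ← sq] at h3 ⊢
  rw [Nat.factorial_succ]
  push_cast at h3 ⊢
  simp only [mul_comm (X.numFacets _ : ℝ)]
  linear_combination (m + 2 : ℝ) * h1 + h2 + 2 * h3

theorem sum_norm_coboundary_contract_sq_le [Fintype V] (φ : X.Cochain (m + 1)) :
    ∑ u, ‖X.coboundary m (contract φ u)‖ ^ 2 ≤
      m * ‖X.coboundary (m + 1) φ‖ ^ 2 + (Fintype.card V + ∑ j ∈ Finset.Icc 2 (m + 1),
        ((m : ℝ) * (m + 1) + j) * X.defect m j) * ‖φ‖ ^ 2 := by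
  set B : ℝ := ∑ j ∈ Finset.Icc 2 (m + 1), ((m : ℝ) * (m + 1) + j) * X.defect m j with hB
  have hf : (0 : ℝ) < (m + 2).factorial := by exact_mod_cast Nat.factorial_pos _
  have h1 := Finset.sum_le_sum fun (s : Fin (m + 2) → V) (_ : s ∈ Finset.univ) =>
    mul_fullCoboundary_sq_le φ s
  rw [Finset.sum_add_distrib, ← Finset.mul_sum, ← factorial_mul_norm_sq,
    sum_sum_comp_succAbove X.defectWeight defectWeight_comp_perm (fun t => φ t ^ 2),
    sum_tuple_succ fun s => X.defectWeight s * φ (s ∘ Fin.succ) ^ 2, Finset.sum_comm] at h1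
  have h2 : ∑ t : Fin (m + 1) → V, ∑ u : V, X.defectWeight (Fin.cons u t : Fin (m + 2) → V) *
      φ ((Fin.cons u t : Fin (m + 2) → V) ∘ Fin.succ) ^ 2 ≤ B * ((m + 1).factorial * ‖φ‖ ^ 2) := by
    rw [factorial_mul_norm_sq, Finset.mul_sum]
    refine Finset.sum_le_sum fun t _ => ?_
    simp only [Fin.cons_comp_succ, ← Finset.sum_mul]
    by_cases ht : X.IsOrderedSimplex t
    · exact mul_le_mul_of_nonneg_right (sum_defectWeight_cons_le ht) (sq_nonneg _)
    · simp [φ.2.1 t ht]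
  have h3 := sum_norm_coboundary_contract_sq φ
  have h4 := mul_le_mul_of_nonneg_left h2 (by positivity : (0 : ℝ) ≤ m + 2)
  refine le_of_mul_le_mul_left ?_ hf
  rw [h3]
  have h5 : ((m + 2).factorial : ℝ) = (m + 2) * (m + 1).factorial := by
    rw [Nat.factorial_succ]
    push_cast
    ring
  push_cast at h1
  rw [h5] at h1 ⊢
  linarith

end AbstractSimplicialComplex

end

open AbstractSimplicialComplex in
theorem theorem1p6 {V : Type*} [Fintype V] (X : AbstractSimplicialComplex V) (k : ℕ)
    (hk : 1 ≤ k) (hX : ∃ σ ∈ X, σ.card = k + 1) :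
    (k : ℝ) * X.minEigenvalue k ≥
      ((k : ℝ) + 1) * X.minEigenvalue (k - 1) - (Fintype.card V : ℝ)
        - ∑ j ∈ Finset.Icc 2 (k + 1),
            ((k : ℝ) * ((k : ℝ) + 1) + (j : ℝ)) * (X.defect k j : ℝ) := by
  obtain ⟨m, rfl⟩ : ∃ m, k = m + 1 := ⟨k - 1, by omega⟩
  rw [Nat.add_sub_cancel]
  have hX' : ∃ σ ∈ X, σ.card = m + 1 := by
    obtain ⟨σ, hσ, hc⟩ := hX
    obtain ⟨τ, hτ, hcτ⟩ := Finset.exists_subset_card_eq (by omega : m + 1 ≤ σ.card)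
    exact ⟨τ, (X.isRelLowerSet_faces hσ).2 hτ (Finset.card_pos.1 (by omega)), hcτ⟩
  obtain ⟨φ, hφ⟩ := (isLeast_minEigenvalue X (m + 1) hX).1.exists_hasEigenvector
  have hpos : 0 < ‖φ‖ ^ 2 := by
    have := norm_pos_iff.2 hφ.2
    positivity
  have h1 : X.minEigenvalue (m + 1) * ‖φ‖ ^ 2 =
      ‖LinearMap.adjoint (X.coboundary (m + 1)) φ‖ ^ 2 + ‖X.coboundary (m + 2) φ‖ ^ 2 := by
    rw [← real_inner_self_eq_norm_sq, ← real_inner_smul_left, ← hφ.apply_eq_smul]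
    exact inner_laplacian_self (m + 1) φ
  have h2 := Finset.sum_le_sum fun (u : V) (_ : u ∈ Finset.univ) =>
    minEigenvalue_mul_norm_sq_le m hX' (contract φ u)
  simp only [inner_laplacian_self] at h2
  rw [← Finset.mul_sum, sum_norm_contract_sq, Finset.sum_add_distrib,
    sum_norm_adjoint_contract_sq] at h2
  have h3 := sum_norm_coboundary_contract_sq_le φ
  refine le_of_mul_le_mul_right ?_ hpos
  push_cast at h1 h2 h3 ⊢
  linear_combination h2 + h3 - (m + 1 : ℝ) * h1
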